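/- Let $N$ be a positive integer and let $\mathcal D_N$ be the set of complex symmetric $N\times N$ matrices $A$ with $A^*A<I$. For $A\in\mathcal D_N$ put $Q_A(z)=zAz^T$ ($z\in\mathbb C^N$ a row vector). Fix $w\in\mathbb C^N$ with $|w|=1$, and for $k=1,2,\dots$ and $z\in\mathbb C^N$ let $$\psi_{A,w}(z)=e^{kQ_A(z-w)/2}\,e^{kz\overline w^T}\,e^{-k|w|^2/2}\,e^{-k|z|^2/2},\qquad \Psi_{A,w}(z)=\frac1{2\pi}\int_0^{2\pi}e^{-ikt}\,\psi_{A,w}(e^{it}z)\,dt .$$ Let $\mathcal H_w=(\mathbb Cw)^\perp$ be the Hermitian orthogonal complement of $\mathbb Cw$. For every $A\in\mathcal D_N$ the limit $$\sigma_A(\eta)=\lim_{k\to\infty}\sqrt k\,\Psi_{A,w}\bigl(w+\eta/\sqrt k\bigr),\qquad \eta\in\mathcal H_w,$$ exists; the function $\sigma_A:\mathcal H_w\to\mathbb C$ is called the symbol of $\Psi_{A,w}$. If $A,B\in\mathcal D_N$ satisfy $\sigma_A=\sigma_B$ on $\mathcal H_w$, then $$\|\Psi_{A,w}-\Psi_{B,w}\|^2_{L^2(S^{2N-1})}=O(k^{-N-1})\qquad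 (k\to\infty),$$ where $S^{2N-1}$ is the unit sphere of $\mathbb C^N$ with its surface measure. -/

import Mathlib

open MeasureTheory Filter Topology Asymptotics
open scoped Matrix ComplexConjugate ComplexOrder

noncomputable section

namespace Squeezed

/-- The Hermitian space `ℂ^N`. -/
abbrev CN (N : ℕ) : Type := EuclideanSpace ℂ (Fin N)

/-- The generalized unit disk: complex symmetric `N × N` matrices `A` with `A^* A < I`. -/
def genDisk (N : ℕ) : Set (Matrix (Fin N) (Fin N) ℂ) :=
  {A | A.IsSymm ∧ (1 - Aᴴ * A).PosDef}

/-- The quadratic form `Q_A(z) = z A z^T`. -/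
def quadForm {N : ℕ} (A : Matrix (Fin N) (Fin N) ℂ) (z : CN N) : ℂ :=
  ∑ i, ∑ j, z i * A i j * z j

/-- The complex bilinear expression `z (conj w)^T`. -/
def hermPair {N : ℕ} (z w : CN N) : ℂ :=
  ∑ i, z i * conj (w i)

/-- The Gaussian coherent state `ψ_{A,w}` on `ℂ^N` at level `k = 1/ℏ`. -/
def gaussianState {N : ℕ} (k : ℕ) (A : Matrix (Fin N) (Fin N) ℂ) (w z : CN N) : ℂ :=
  Complex.exp ((k : ℂ) * quadForm A (z - w) / 2) *
    Complex.exp ((k : ℂ) * hermPair z w) *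
    Complex.exp (-((k : ℂ) * ((‖w‖ ^ 2 : ℝ) : ℂ) / 2)) *
    Complex.exp (-((k : ℂ) * ((‖z‖ ^ 2 : ℝ) : ℂ) / 2))

/-- The reduction operator `(R_k ψ)(z) = (1/2π) ∫_0^{2π} e^{-ikt} ψ(e^{it} z) dt`.  The formula is
used on the unit sphere and also at the points `w + η/√k` near it. -/
def reduction {N : ℕ} (k : ℕ) (ψ : CN N → ℂ) (z : CN N) : ℂ :=
  1 / (2 * (Real.pi : ℂ)) *
    ∫ t in (0 : ℝ)..(2 * Real.pi),
      Complex.exp (-(Complex.I * (k : ℂ) * (t : ℂ))) * ψ (Complex.exp (Complex.I * (t : ℂ)) • z)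

/-- The reduced state `Ψ_{A,w} = R_k(ψ_{A,w})`. -/
def reducedState {N : ℕ} (k : ℕ) (A : Matrix (Fin N) (Fin N) ℂ) (w : CN N) : CN N → ℂ :=
  reduction k (gaussianState k A w)

/-- `H_w`, the Hermitian orthogonal complement of the complex line spanned by `w`. -/
abbrev horizontal {N : ℕ} (w : CN N) : Submodule ℂ (CN N) := (Submodule.span ℂ {w})ᗮ

/-- The rescaled reduced state `√k Ψ_{A,w}(w + η/√k)`. -/
def rescaledState {N : ℕ} (A : Matrix (Fin N) (Fin N) ℂ) (w : CN N) (η : horizontal w) (k : ℕ) :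
    ℂ :=
  ((√(k : ℝ) : ℝ) : ℂ) * reducedState k A w (w + (((√(k : ℝ))⁻¹ : ℝ) : ℂ) • (η : CN N))

/-- The symbol `σ_A : H_w → ℂ`, `σ_A(η) = lim_{k → ∞} √k Ψ_{A,w}(w + η/√k)`. -/
def symbol {N : ℕ} (A : Matrix (Fin N) (Fin N) ℂ) (w : CN N) (η : horizontal w) : ℂ :=
  limUnder atTop (rescaledState A w η)

/-- The squared norm of a function on `ℂ^N` in `L²(S^{2N-1})`, for the surface measure of the unit
sphere. -/
def sphereNormSq {N : ℕ} (f : CN N → ℂ) : ℝ :=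
  ∫ z : Metric.sphere (0 : CN N) 1, ‖f z‖ ^ 2 ∂((volume : Measure (CN N)).toSphere)

theorem continuous_reducedState {N : ℕ} (k : ℕ) (A : Matrix (Fin N) (Fin N) ℂ) (w : CN N) :
    Continuous (reducedState k A w) := by
  unfold reducedState reduction
  refine continuous_const.mul ?_
  apply intervalIntegral.continuous_parametric_intervalIntegral_of_continuous'
  unfold Function.uncurry gaussianState quadForm hermPair
  fun_prop

/-- The integrand in the squared norm of a difference of reduced states is integrable. -/
theorem integrable_reducedState_sub {N : ℕ} (k : ℕ) (A B : Matrix (Fin N) (Fin N) ℂ) (w : CN N) :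
    Integrable (fun z : Metric.sphere (0 : CN N) 1 =>
      ‖(reducedState k A w - reducedState k B w) z‖ ^ 2)
      ((volume : Measure (CN N)).toSphere) := by
  have hc : Continuous (fun z : Metric.sphere (0 : CN N) 1 =>
      ‖(reducedState k A w - reducedState k B w) z‖ ^ 2) :=
    ((((continuous_reducedState k A w).sub (continuous_reducedState k B w)).comp
      continuous_subtype_val).norm).pow 2
  exact hc.integrable_of_hasCompactSupport (HasCompactSupport.of_compactSpace _)

end Squeezed

end

/-!
Along the circle orbit of a unit vector `z`, the integrand of `Ψ_{A,w}(z)` is `e^{kφ(t)}`. By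
equivariance `z` can be taken to be `r w + ζ` with `ζ` in `H_w` and `r ≥ 0`. Then `φ(t)` is a
quadratic form in the tangent displacement `u = i t w + ζ`, up to an error cubic in `|u|`, and
`Re φ(t) ≤ -c |u|²` because `Re Q_A(v) < |v|²` for `v ≠ 0`. Replacing `φ` by its quadratic part
turns `Ψ_{A,w}(z)` into `k^{-1/2} σ_A(√k ζ)`, a Gaussian integral over the tangent line, at the
cost of an error at most `C k⁻¹ e^{-a k |ζ|²}` that is uniform in `z`. This bound gives the limit
defining `σ_A`. When the symbols agree it bounds `Ψ_{A,w} - Ψ_{B,w}`, and the mass of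
`e^{-2 a k |ζ|²}` on the sphere is `O(k^{-(N-1)})`, since `H_w` has real dimension `2(N-1)`.
-/

noncomputable section

namespace Squeezed

section SphereConcentration

theorem lintegral_toSphere_le {V : Type*} [NormedAddCommGroup V] [NormedSpace ℝ V]
    [MeasurableSpace V] [BorelSpace V] (μ : Measure V) {f : Metric.sphere (0 : V) 1 → ENNReal}
    {F : V → ENNReal} (hf : Measurable f)
    (hfF : ∀ s : Metric.sphere (0 : V) 1, ∀ ρ : ℝ, 0 < ρ → ρ < 1 → f s ≤ F (ρ • (s : V))) :
    ∫⁻ s, f s ∂μ.toSphere ≤ Module.finrank ℝ V * ∫⁻ v, F v ∂μ := by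
  have hpolar : MeasurableEmbedding (Subtype.val ∘ (homeomorphUnitSphereProd V).symm) :=
    (MeasurableEmbedding.subtype_coe (measurableSet_singleton _).compl).comp
      (Homeomorph.measurableEmbedding _)
  rw [Measure.toSphere, lintegral_smul_measure, nsmul_eq_mul, Measure.fst,
    lintegral_map hf measurable_fst]
  gcongr
  let shell : Set (Metric.sphere (0 : V) 1 × Set.Ioi (0 : ℝ)) :=
    Set.univ ×ˢ Set.Iio ⟨1, Set.mem_Ioi.2 one_pos⟩
  calc ∫⁻ p in shell, f p.1 ∂μ.comap _
      ≤ ∫⁻ p in shell, F ((Subtype.val ∘ (homeomorphUnitSphereProd V).symm) p) ∂μ.comap _ :=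
        setLIntegral_mono' (MeasurableSet.univ.prod measurableSet_Iio)
          fun p hp => hfF p.1 p.2 p.2.2 hp.2
    _ ≤ ∫⁻ p, F ((Subtype.val ∘ (homeomorphUnitSphereProd V).symm) p) ∂μ.comap _ :=
        setLIntegral_le_lintegral _ _
    _ = ∫⁻ v in Set.range (Subtype.val ∘ (homeomorphUnitSphereProd V).symm), F v ∂μ := by
        rw [← hpolar.lintegral_map, hpolar.map_comap]
    _ ≤ ∫⁻ v, F v ∂μ := setLIntegral_le_lintegral _ _

variable {V : Type*} [NormedAddCommGroup V] [InnerProductSpace ℝ V] [FiniteDimensional ℝ V]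
  [MeasurableSpace V] [BorelSpace V]

theorem lintegral_exp_neg_mul_norm_sq {b : ℝ} (hb : 0 < b) :
    ∫⁻ v : V, ENNReal.ofReal (Real.exp (-b * ‖v‖ ^ 2)) =
      ENNReal.ofReal ((Real.pi / b) ^ (Module.finrank ℝ V / 2 : ℝ)) := by
  have hgauss := GaussianFourier.integral_rexp_neg_mul_sq_norm (V := V) hb
  rw [← hgauss, ofReal_integral_eq_lintegral_ofReal _ (.of_forall fun _ => (Real.exp_pos _).le)]
  exact .of_integral_ne_zero (by rw [hgauss]; positivity)

theorem lintegral_exp_neg_norm_starProjection_sq (K : Submodule ℝ V) {a b : ℝ} (ha : 0 < a)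
    (hb : 0 < b) :
    ∫⁻ v : V, ENNReal.ofReal
        (Real.exp (-a * ‖K.starProjection v‖ ^ 2 + -b * ‖Kᗮ.starProjection v‖ ^ 2)) =
      ENNReal.ofReal ((Real.pi / a) ^ (Module.finrank ℝ K / 2 : ℝ) *
        (Real.pi / b) ^ (Module.finrank ℝ Kᗮ / 2 : ℝ)) := by
  have hsplit := (WithLp.volume_preserving_ofLp K Kᗮ).comp
    (LinearIsometryEquiv.measurePreserving K.orthogonalDecomposition)
  have hmeas : Measurable fun p : K × Kᗮ => ENNReal.ofReal (Real.exp (-a * ‖p.1‖ ^ 2)) *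
      ENNReal.ofReal (Real.exp (-b * ‖p.2‖ ^ 2)) := by fun_prop
  rw [ENNReal.ofReal_mul (by positivity), ← lintegral_exp_neg_mul_norm_sq ha,
    ← lintegral_exp_neg_mul_norm_sq hb, ← lintegral_prod_mul (by fun_prop) (by fun_prop),
    ← Measure.volume_eq_prod, ← hsplit.lintegral_comp hmeas]
  refine lintegral_congr fun v => ?_
  rw [Real.exp_add, ENNReal.ofReal_mul (Real.exp_pos _).le]
  simp only [Function.comp_apply, Submodule.orthogonalDecomposition_apply, Submodule.coe_norm,
    Submodule.coe_orthogonalProjectionOnto_apply]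

theorem integral_sphere_exp_neg_norm_starProjection_sq_le (K : Submodule ℝ V) {b : ℝ}
    (hb : 0 < b) :
    ∫ z : Metric.sphere (0 : V) 1, Real.exp (-b * ‖K.starProjection z‖ ^ 2)
        ∂(volume : Measure V).toSphere ≤
      Module.finrank ℝ V * Real.exp 1 *
        ((Real.pi / b) ^ (Module.finrank ℝ K / 2 : ℝ) *
          Real.pi ^ (Module.finrank ℝ Kᗮ / 2 : ℝ)) := by
  have hcont : Continuous fun z : Metric.sphere (0 : V) 1 =>
      Real.exp (-b * ‖K.starProjection z‖ ^ 2) := by fun_prop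
  rw [integral_eq_lintegral_of_nonneg_ae (.of_forall fun _ => (Real.exp_pos _).le)
    hcont.aestronglyMeasurable]
  refine ENNReal.toReal_le_of_le_ofReal (by positivity) ?_
  have hle := lintegral_toSphere_le (volume : Measure V)
    (F := fun v => ENNReal.ofReal (Real.exp 1) * ENNReal.ofReal
      (Real.exp (-b * ‖K.starProjection v‖ ^ 2 + -1 * ‖Kᗮ.starProjection v‖ ^ 2)))
    hcont.measurable.ennreal_ofReal fun s ρ hρ0 hρ1 => ?_
  · rwa [lintegral_const_mul' _ _ ENNReal.ofReal_ne_top,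
      lintegral_exp_neg_norm_starProjection_sq K hb one_pos, div_one,
      ← ENNReal.ofReal_natCast, ← ENNReal.ofReal_mul (Real.exp_pos _).le,
      ← ENNReal.ofReal_mul (by positivity), ← mul_assoc] at hle
  · have hK : ‖K.starProjection (ρ • (s : V))‖ ≤ ‖K.starProjection (s : V)‖ := by
      rw [map_smul, norm_smul, Real.norm_of_nonneg hρ0.le]
      exact mul_le_of_le_one_left (norm_nonneg _) hρ1.le
    have hKperp : ‖Kᗮ.starProjection (ρ • (s : V))‖ ≤ 1 := by
      refine (Kᗮ.norm_starProjection_apply_le _).trans ?_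
      rw [norm_smul, norm_eq_of_mem_sphere, mul_one, Real.norm_of_nonneg hρ0.le]
      exact hρ1.le
    rw [← ENNReal.ofReal_mul (Real.exp_pos _).le, ← Real.exp_add]
    refine ENNReal.ofReal_le_ofReal (Real.exp_le_exp.2 ?_)
    have hbK := mul_le_mul_of_nonneg_left (pow_le_pow_left₀ (norm_nonneg _) hK 2) hb.le
    have hsq := pow_le_one₀ (n := 2) (norm_nonneg _) hKperp
    linarith

end SphereConcentration

section CircleGeometry

variable {E : Type*} [NormedAddCommGroup E] [InnerProductSpace ℂ E]

/-- The displacement `e^{it} z - w` from `w` of the point of the circle orbit of `z` at time `t`. -/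
def circleDisplacement (w z : E) (t : ℝ) : E := Complex.exp (Complex.I * t) • z - w

/-- The first-order part `i t w + ζ` of the displacement `e^{it} (r w + ζ) - w`. Its remainder is
quadratic because `1 - r` is at most `‖ζ‖²`, which holds for `w + ζ` and on the unit sphere. -/
def tangentDisplacement (w ζ : E) (t : ℝ) : E := (Complex.I * t) • w + ζ

theorem norm_smul_add_smul_sq {w ζ : E} (hw : ‖w‖ = 1) (hζ : inner ℂ w ζ = 0) (a : ℂ) {b : ℂ}
    (hb : ‖b‖ = 1) : ‖a • w + b • ζ‖ ^ 2 = ‖a‖ ^ 2 + ‖ζ‖ ^ 2 := by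
  have horth : inner ℂ (a • w) (b • ζ) = 0 := by
    rw [inner_smul_left, inner_smul_right, hζ, mul_zero, mul_zero]
  have hpyth := norm_add_sq_eq_norm_sq_add_norm_sq_of_inner_eq_zero _ _ horth
  simpa only [norm_smul, hw, hb, mul_one, one_mul, ← sq] using hpyth

theorem norm_tangentDisplacement_sq {w ζ : E} (hw : ‖w‖ = 1) (hζ : inner ℂ w ζ = 0) (t : ℝ) :
    ‖tangentDisplacement w ζ t‖ ^ 2 = t ^ 2 + ‖ζ‖ ^ 2 := by
  simpa [tangentDisplacement] using norm_smul_add_smul_sq hw hζ (Complex.I * t) norm_one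

theorem abs_le_norm_tangentDisplacement {w ζ : E} (hw : ‖w‖ = 1) (hζ : inner ℂ w ζ = 0) (t : ℝ) :
    |t| ≤ ‖tangentDisplacement w ζ t‖ :=
  abs_le_of_sq_le_sq (by rw [norm_tangentDisplacement_sq hw hζ]; nlinarith [sq_nonneg ‖ζ‖])
    (norm_nonneg _)

theorem norm_le_norm_tangentDisplacement {w ζ : E} (hw : ‖w‖ = 1) (hζ : inner ℂ w ζ = 0)
    (t : ℝ) : ‖ζ‖ ≤ ‖tangentDisplacement w ζ t‖ :=
  le_of_sq_le_sq (by rw [norm_tangentDisplacement_sq hw hζ]; nlinarith [sq_nonneg t])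
    (norm_nonneg _)

theorem norm_exp_I_mul_sub_one_sub_le (t : ℝ) :
    ‖Complex.exp (Complex.I * t) - 1 - Complex.I * t‖ ≤ 2 * t ^ 2 := by
  have hnorm : ‖Complex.I * (t : ℂ)‖ = |t| := by simp
  rw [← sq_abs]
  rcases le_total |t| 1 with ht | ht
  · have htaylor := Complex.norm_exp_sub_one_sub_id_le (x := Complex.I * t) (hnorm.trans_le ht)
    rw [hnorm] at htaylor
    linarith [sq_nonneg |t|]
  · have htriangle := norm_sub_le (Complex.exp (Complex.I * t) - 1) (Complex.I * t)
    have hchord : ‖Complex.exp (Complex.I * t) - 1‖ ≤ |t| :=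
      Real.norm_exp_I_mul_ofReal_sub_one_le
    rw [hnorm] at htriangle
    nlinarith

theorem norm_exp_I_mul_mul_sub_one_sq (r t : ℝ) :
    ‖Complex.exp (Complex.I * t) * r - 1‖ ^ 2 = (1 - r) ^ 2 + 2 * r * (1 - Real.cos t) := by
  rw [← Complex.normSq_eq_norm_sq, Complex.normSq_apply, mul_comm Complex.I]
  simp only [Complex.sub_re, Complex.sub_im, Complex.re_mul_ofReal, Complex.im_mul_ofReal,
    Complex.exp_ofReal_mul_I_re, Complex.exp_ofReal_mul_I_im, Complex.one_re, Complex.one_im]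
  linear_combination r ^ 2 * Real.sin_sq_add_cos_sq t

theorem norm_tangentDisplacement_sq_le {w ζ : E} (hw : ‖w‖ = 1) (hζ : inner ℂ w ζ = 0) {r : ℝ}
    (hr : 0 ≤ r) (hrζ : 1 - r ≤ ‖ζ‖ ^ 2) {t : ℝ} (ht : |t| ≤ Real.pi) :
    ‖tangentDisplacement w ζ t‖ ^ 2 ≤
      2 * Real.pi ^ 2 * ‖circleDisplacement w ((r : ℂ) • w + ζ) t‖ ^ 2 := by
  have hcircle : circleDisplacement w ((r : ℂ) • w + ζ) t =
      (Complex.exp (Complex.I * t) * r - 1) • w + Complex.exp (Complex.I * t) • ζ := by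
    rw [circleDisplacement]; module
  rw [hcircle, norm_smul_add_smul_sq hw hζ _ (Complex.norm_exp_I_mul_ofReal t),
    norm_exp_I_mul_mul_sub_one_sq, norm_tangentDisplacement_sq hw hζ]
  have hcos : 2 * t ^ 2 ≤ Real.pi ^ 2 * (1 - Real.cos t) := by
    have hquad := Real.cos_le_one_sub_mul_cos_sq ht
    rw [div_mul_eq_mul_div, le_sub_comm, div_le_iff₀ (by positivity)] at hquad
    linarith
  have htpi : t ^ 2 ≤ Real.pi ^ 2 := sq_le_sq' (abs_le.1 ht).1 (abs_le.1 ht).2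
  have hpi : 1 ≤ Real.pi ^ 2 := one_le_pow₀ (by linarith [Real.pi_gt_three])
  have hrcos := mul_le_mul_of_nonneg_left hcos hr
  have hradial := mul_le_mul_of_nonneg_left hrζ (sq_nonneg t)
  nlinarith [mul_le_mul_of_nonneg_right htpi (sq_nonneg ‖ζ‖), sq_nonneg ‖ζ‖, sq_nonneg (1 - r),
    mul_le_mul_of_nonneg_right hpi (sq_nonneg ‖ζ‖), mul_nonneg hr (sq_nonneg t)]

theorem norm_circleDisplacement_sub_tangentDisplacement_le {w ζ : E} (hw : ‖w‖ = 1)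
    (hζ : inner ℂ w ζ = 0) {r : ℝ} (hr : r ≤ 1) (hrζ : 1 - r ≤ ‖ζ‖ ^ 2) (t : ℝ) :
    ‖circleDisplacement w ((r : ℂ) • w + ζ) t - tangentDisplacement w ζ t‖ ≤
      3 * ‖tangentDisplacement w ζ t‖ ^ 2 := by
  have hsplit : circleDisplacement w ((r : ℂ) • w + ζ) t - tangentDisplacement w ζ t =
      (Complex.exp (Complex.I * t) - 1 - Complex.I * t) • w +
        (Complex.exp (Complex.I * t) * ((r - 1 : ℝ) : ℂ)) • w +
        (Complex.exp (Complex.I * t) - 1) • ζ := by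
    rw [circleDisplacement, tangentDisplacement]; push_cast; module
  have hchord : ‖Complex.exp (Complex.I * t) - 1‖ ≤ |t| := Real.norm_exp_I_mul_ofReal_sub_one_le
  calc _ ≤ 2 * t ^ 2 + (1 - r) + |t| * ‖ζ‖ := by
        rw [hsplit]
        refine norm_add₃_le.trans ?_
        rw [norm_smul, norm_smul, norm_smul, hw, norm_mul, Complex.norm_exp_I_mul_ofReal,
          Complex.norm_real, Real.norm_of_nonpos (by linarith), mul_one, mul_one, one_mul, neg_sub]
        gcongr
        exact norm_exp_I_mul_sub_one_sub_le t
    _ ≤ 3 * (t ^ 2 + ‖ζ‖ ^ 2) := by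
        rw [← sq_abs t]
        nlinarith [two_mul_le_add_sq |t| ‖ζ‖, sq_nonneg |t|]
    _ = _ := by rw [norm_tangentDisplacement_sq hw hζ]

theorem norm_circleDisplacement_le {w ζ : E} (hw : ‖w‖ = 1) (hζ : inner ℂ w ζ = 0) {r : ℝ}
    (hr0 : 0 ≤ r) (hr1 : r ≤ 1) (hrζ : 1 - r ≤ ‖ζ‖ ^ 2) (t : ℝ) :
    ‖circleDisplacement w ((r : ℂ) • w + ζ) t‖ ≤ 3 * ‖tangentDisplacement w ζ t‖ := by
  have hsplit : circleDisplacement w ((r : ℂ) • w + ζ) t =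
      (Complex.exp (Complex.I * t) - 1) • w +
        (Complex.exp (Complex.I * t) * ((r - 1 : ℝ) : ℂ)) • w +
        Complex.exp (Complex.I * t) • ζ := by
    rw [circleDisplacement]; push_cast; module
  have hradial : 1 - r ≤ ‖ζ‖ := by
    rcases le_total ‖ζ‖ 1 with h | h
    · nlinarith [norm_nonneg ζ]
    · linarith
  have hchord : ‖Complex.exp (Complex.I * t) - 1‖ ≤ |t| := Real.norm_exp_I_mul_ofReal_sub_one_le
  calc _ ≤ |t| + (1 - r) + ‖ζ‖ := by
        rw [hsplit]
        refine norm_add₃_le.trans ?_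
        rwa [norm_smul, norm_smul, norm_smul, hw, norm_mul, Complex.norm_exp_I_mul_ofReal,
          Complex.norm_real, Real.norm_of_nonpos (by linarith), mul_one, mul_one, one_mul, one_mul,
          neg_sub, add_le_add_iff_right, add_le_add_iff_right]
    _ ≤ 3 * ‖tangentDisplacement w ζ t‖ := by
        linarith [abs_le_norm_tangentDisplacement hw hζ t,
          norm_le_norm_tangentDisplacement hw hζ t]

theorem abs_im_exp_mul_inner_sub_le {w ζ : E} (hw : ‖w‖ = 1) (hζ : inner ℂ w ζ = 0) {r : ℝ}
    (hr0 : 0 ≤ r) (hr1 : r ≤ 1) (hrζ : 1 - r ≤ ‖ζ‖ ^ 2) (t : ℝ) :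
    |(Complex.exp (Complex.I * t) * inner ℂ w ((r : ℂ) • w + ζ)).im - t| ≤
      ‖tangentDisplacement w ζ t‖ ^ 3 := by
  have hinner : inner ℂ w ((r : ℂ) • w + ζ) = (r : ℂ) := by
    rw [inner_add_right, inner_smul_right, hζ, inner_self_eq_norm_sq_to_K, hw]
    simp
  rw [hinner, Complex.im_mul_ofReal, mul_comm Complex.I, Complex.exp_ofReal_mul_I_im]
  calc |Real.sin t * r - t| = |-(r * (t - Real.sin t)) - (1 - r) * t| := by ring_nf
    _ ≤ |-(r * (t - Real.sin t))| + |(1 - r) * t| := abs_sub _ _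
    _ = r * |t - Real.sin t| + (1 - r) * |t| := by
        rw [abs_neg, abs_mul, abs_mul, abs_of_nonneg hr0, abs_of_nonneg (sub_nonneg.2 hr1)]
    _ ≤ 1 * (|t| ^ 3 / 6) + ‖ζ‖ ^ 2 * |t| := by
        gcongr
        exact Real.abs_sub_sin_le t
    _ ≤ (|t| ^ 2 + ‖ζ‖ ^ 2) * |t| := by nlinarith [pow_nonneg (abs_nonneg t) 3]
    _ = ‖tangentDisplacement w ζ t‖ ^ 2 * |t| := by
        rw [sq_abs, norm_tangentDisplacement_sq hw hζ]
    _ ≤ ‖tangentDisplacement w ζ t‖ ^ 3 := by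
        rw [pow_succ _ 2]
        gcongr
        exact abs_le_norm_tangentDisplacement hw hζ t

theorem exists_eq_exp_smul_of_norm_eq_one {w z : E} (hw : ‖w‖ = 1) (hz : ‖z‖ = 1) :
    ∃ (θ r : ℝ) (ζ : E), inner ℂ w ζ = 0 ∧ 0 ≤ r ∧ r ≤ 1 ∧ 1 - r ≤ ‖ζ‖ ^ 2 ∧
      ‖ζ‖ = ‖(Submodule.span ℂ {w})ᗮ.starProjection z‖ ∧
      z = Complex.exp (Complex.I * θ) • ((r : ℂ) • w + ζ) := by
  set h : ℂ := inner ℂ w z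
  set p := (Submodule.span ℂ {w})ᗮ.starProjection z
  set e := Complex.exp (Complex.I * h.arg)
  have he : ‖e⁻¹‖ = 1 := by rw [norm_inv, Complex.norm_exp_I_mul_ofReal, inv_one]
  have hp : inner ℂ w p = 0 :=
    Submodule.mem_orthogonal_singleton_iff_inner_right.1 (Submodule.starProjection_apply_mem _ z)
  have hdecomp : z = h • w + p := by
    rw [← Submodule.starProjection_unit_singleton ℂ hw,
      Submodule.starProjection_add_starProjection_orthogonal]
  have hpolar : e * ‖h‖ = h := by
    simp only [e, mul_comm Complex.I, mul_comm _ (‖h‖ : ℂ), Complex.norm_mul_exp_arg_mul_I]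
  have hpyth : 1 = ‖h‖ ^ 2 + ‖p‖ ^ 2 := by
    rw [← norm_smul_add_smul_sq hw hp h norm_one, one_smul, ← hdecomp, hz, one_pow]
  have hnorm : ‖e⁻¹ • p‖ = ‖p‖ := by rw [norm_smul, he, one_mul]
  have hh : ‖h‖ ≤ 1 := by nlinarith [norm_nonneg h, sq_nonneg ‖p‖]
  refine ⟨h.arg, ‖h‖, e⁻¹ • p, by rw [inner_smul_right, hp, mul_zero], norm_nonneg h, hh, ?_,
    hnorm, ?_⟩
  · rw [hnorm]
    nlinarith [norm_nonneg h]
  · rw [smul_add, smul_smul, hpolar, smul_inv_smul₀ (Complex.exp_ne_zero _), ← hdecomp]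

end CircleGeometry

section StationaryPhase

theorem norm_apply_self_sub_apply_self_le {E : Type*} [NormedAddCommGroup E] [NormedSpace ℝ E]
    (β : E →L[ℝ] E →L[ℝ] ℂ) (u v : E) :
    ‖β u u - β v v‖ ≤ ‖β‖ * ((‖u‖ + ‖v‖) * ‖u - v‖) := by
  have hsplit : β u u - β v v = β (u - v) u + β v (u - v) := by
    simp only [map_sub, sub_apply]; ring
  rw [hsplit]
  refine (norm_add_le_of_le (β.le_opNorm₂ _ _) (β.le_opNorm₂ _ _)).trans_eq ?_
  ring

theorem norm_exp_sub_exp_le {x y : ℂ} {m : ℝ} (hx : x.re ≤ m) (hy : y.re ≤ m) :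
    ‖Complex.exp x - Complex.exp y‖ ≤ Real.exp m * ‖x - y‖ := by
  refine Convex.norm_image_sub_le_of_norm_hasDerivWithin_le (s := {z : ℂ | z.re ≤ m})
    (fun z _ => (Complex.hasDerivAt_exp z).hasDerivWithinAt) (fun z hz => ?_)
    (convex_halfSpace_re_le m) hy hx
  rw [Complex.norm_exp]
  exact Real.exp_le_exp.2 hz

theorem cube_mul_exp_neg_mul_sq_le {a : ℝ} (ha : 0 < a) (y : ℝ) :
    y ^ 3 * Real.exp (-a * y ^ 2) ≤ (1 + 8 / a ^ 2) * Real.exp (-(a / 2) * y ^ 2) := by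
  have hcube : y ^ 3 ≤ (1 + 8 / a ^ 2) * Real.exp (a / 2 * y ^ 2) := by
    have hquad := Real.quadratic_le_exp_of_nonneg (x := a / 2 * y ^ 2) (by positivity)
    have hfour : y ^ 4 = 8 / a ^ 2 * ((a / 2 * y ^ 2) ^ 2 / 2) := by field_simp; ring
    have hexp : (a / 2 * y ^ 2) ^ 2 / 2 ≤ Real.exp (a / 2 * y ^ 2) := by
      nlinarith [mul_nonneg ha.le (sq_nonneg y)]
    calc y ^ 3 ≤ 1 + y ^ 4 := by nlinarith [sq_nonneg (y ^ 2 - y), sq_nonneg (y - 1)]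
      _ ≤ Real.exp (a / 2 * y ^ 2) + 8 / a ^ 2 * Real.exp (a / 2 * y ^ 2) := by
        rw [hfour]
        gcongr
        exact Real.one_le_exp (by positivity)
      _ = _ := by ring
  calc y ^ 3 * Real.exp (-a * y ^ 2)
      ≤ (1 + 8 / a ^ 2) * Real.exp (a / 2 * y ^ 2) * Real.exp (-a * y ^ 2) := by gcongr
    _ = _ := by rw [mul_assoc, ← Real.exp_add]; ring_nf

theorem mul_cube_mul_exp_neg_mul_sq_le {a κ : ℝ} (ha : 0 < a) (hκ : 0 < κ) (s : ℝ) :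
    κ * s ^ 3 * Real.exp (-a * κ * s ^ 2) ≤
      (1 + 8 / a ^ 2) * (√κ)⁻¹ * Real.exp (-(a / 2) * κ * s ^ 2) := by
  obtain ⟨q, hq, rfl⟩ : ∃ q, 0 < q ∧ q ^ 2 = κ := ⟨√κ, Real.sqrt_pos.2 hκ, Real.sq_sqrt hκ.le⟩
  rw [Real.sqrt_sq hq.le]
  have hscaled := mul_le_mul_of_nonneg_left (cube_mul_exp_neg_mul_sq_le ha (q * s))
    (inv_pos.2 hq).le
  refine (Eq.trans_le ?_ hscaled).trans_eq ?_
  · field_simp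
  · ring_nf

variable {E : Type*} [NormedAddCommGroup E] [InnerProductSpace ℂ E] [NormedSpace ℝ E]

/-- The exponent of the reduction integrand at `z`, divided by `k`, for the state with quadratic
exponent `β` centred at `w`. In the imaginary term, `-t` comes from the weight `e^{-ikt}` and the
rest from the factor `e^{kzw*}`, whose modulus is absorbed into `β`. -/
def circlePhase (β : E →L[ℝ] E →L[ℝ] ℂ) (w z : E) (t : ℝ) : ℂ :=
  β (circleDisplacement w z t) (circleDisplacement w z t) +
    Complex.I * ((Complex.exp (Complex.I * t) * inner ℂ w z).im - t : ℝ)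

/-- The Gaussian integral over the tangent line of the circle orbit of `w` that computes the
symbol. -/
def symbolIntegral (β : E →L[ℝ] E →L[ℝ] ℂ) (w ζ : E) : ℂ :=
  1 / (2 * Real.pi) *
    ∫ t : ℝ, Complex.exp (β (tangentDisplacement w ζ t) (tangentDisplacement w ζ t))

theorem continuous_circlePhase (β : E →L[ℝ] E →L[ℝ] ℂ) (w z : E) :
    Continuous (circlePhase β w z) := by
  unfold circlePhase circleDisplacement
  fun_prop

theorem continuous_tangentPhase (β : E →L[ℝ] E →L[ℝ] ℂ) (w ζ : E) :
    Continuous fun t => β (tangentDisplacement w ζ t) (tangentDisplacement w ζ t) := by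
  unfold tangentDisplacement
  fun_prop

theorem norm_circlePhase_sub_le (β : E →L[ℝ] E →L[ℝ] ℂ) {w ζ : E} (hw : ‖w‖ = 1)
    (hζ : inner ℂ w ζ = 0) {r : ℝ} (hr0 : 0 ≤ r) (hr1 : r ≤ 1) (hrζ : 1 - r ≤ ‖ζ‖ ^ 2) (t : ℝ) :
    ‖circlePhase β w ((r : ℂ) • w + ζ) t -
        β (tangentDisplacement w ζ t) (tangentDisplacement w ζ t)‖ ≤
      (12 * ‖β‖ + 1) * ‖tangentDisplacement w ζ t‖ ^ 3 := by
  rw [circlePhase, add_sub_right_comm]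
  refine (norm_add_le_of_le (norm_apply_self_sub_apply_self_le β _ _) (le_refl _)).trans ?_
  rw [norm_mul, Complex.norm_I, one_mul, Complex.norm_real, Real.norm_eq_abs]
  calc _ ≤ ‖β‖ * ((3 * ‖tangentDisplacement w ζ t‖ + ‖tangentDisplacement w ζ t‖) *
          (3 * ‖tangentDisplacement w ζ t‖ ^ 2)) + ‖tangentDisplacement w ζ t‖ ^ 3 := by
        gcongr
        · exact norm_circleDisplacement_le hw hζ hr0 hr1 hrζ t
        · exact norm_circleDisplacement_sub_tangentDisplacement_le hw hζ hr1 hrζ t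
        · exact abs_im_exp_mul_inner_sub_le hw hζ hr0 hr1 hrζ t
    _ = _ := by ring

variable {β : E →L[ℝ] E →L[ℝ] ℂ} {c : ℝ} {w ζ : E}

theorem re_tangentPhase_le (hc : 0 ≤ c) (hβ : ∀ v, (β v v).re ≤ -c * ‖v‖ ^ 2) (t : ℝ) :
    (β (tangentDisplacement w ζ t) (tangentDisplacement w ζ t)).re ≤
      -(c / (2 * Real.pi ^ 2)) * ‖tangentDisplacement w ζ t‖ ^ 2 := by
  refine (hβ _).trans (mul_le_mul_of_nonneg_right (neg_le_neg ?_) (sq_nonneg _))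
  exact div_le_self hc (by nlinarith [Real.pi_gt_three])

theorem re_circlePhase_le (hc : 0 ≤ c) (hβ : ∀ v, (β v v).re ≤ -c * ‖v‖ ^ 2) (hw : ‖w‖ = 1)
    (hζ : inner ℂ w ζ = 0) {r : ℝ} (hr : 0 ≤ r) (hrζ : 1 - r ≤ ‖ζ‖ ^ 2) {t : ℝ}
    (ht : |t| ≤ Real.pi) :
    (circlePhase β w ((r : ℂ) • w + ζ) t).re ≤
      -(c / (2 * Real.pi ^ 2)) * ‖tangentDisplacement w ζ t‖ ^ 2 := by
  have hdisp := mul_le_mul_of_nonneg_left (norm_tangentDisplacement_sq_le hw hζ hr hrζ ht)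
    (show 0 ≤ c / (2 * Real.pi ^ 2) by positivity)
  rw [← mul_assoc, div_mul_cancel₀ _ (by positivity)] at hdisp
  rw [circlePhase, Complex.add_re, Complex.I_mul_re, Complex.ofReal_im, neg_zero, add_zero]
  linarith [hβ (circleDisplacement w ((r : ℂ) • w + ζ) t)]

theorem norm_indicator_exp_circlePhase_sub_le (hc : 0 ≤ c) (hβ : ∀ v, (β v v).re ≤ -c * ‖v‖ ^ 2)
    (hw : ‖w‖ = 1) (hζ : inner ℂ w ζ = 0) {r : ℝ} (hr0 : 0 ≤ r) (hr1 : r ≤ 1)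
    (hrζ : 1 - r ≤ ‖ζ‖ ^ 2) {κ : ℝ} (hκ : 1 ≤ κ) (t : ℝ) :
    ‖(Set.Ioc (-Real.pi) Real.pi).indicator
          (fun t => Complex.exp (κ * circlePhase β w ((r : ℂ) • w + ζ) t)) t -
        Complex.exp (κ * β (tangentDisplacement w ζ t) (tangentDisplacement w ζ t))‖ ≤
      (12 * ‖β‖ + 1) * (κ * ‖tangentDisplacement w ζ t‖ ^ 3 *
        Real.exp (-(c / (2 * Real.pi ^ 2)) * κ * ‖tangentDisplacement w ζ t‖ ^ 2)) := by
  set s := ‖tangentDisplacement w ζ t‖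
  have hre : ∀ {x : ℂ}, x.re ≤ -(c / (2 * Real.pi ^ 2)) * s ^ 2 →
      (κ * x).re ≤ -(c / (2 * Real.pi ^ 2)) * κ * s ^ 2 := fun {x} hx => by
    rw [Complex.re_ofReal_mul]
    linarith [mul_le_mul_of_nonneg_left hx (zero_le_one.trans hκ)]
  have htangent := hre (re_tangentPhase_le (w := w) (ζ := ζ) hc hβ t)
  by_cases ht : t ∈ Set.Ioc (-Real.pi) Real.pi
  · rw [Set.indicator_of_mem ht]
    have hcircle := hre (re_circlePhase_le hc hβ hw hζ hr0 hrζ (abs_le.2 ⟨ht.1.le, ht.2⟩))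
    refine (norm_exp_sub_exp_le hcircle htangent).trans ?_
    rw [← mul_sub, norm_mul, Complex.norm_real, Real.norm_of_nonneg (zero_le_one.trans hκ)]
    calc _ ≤ Real.exp (-(c / (2 * Real.pi ^ 2)) * κ * s ^ 2) *
          (κ * ((12 * ‖β‖ + 1) * s ^ 3)) := by
          gcongr
          exact norm_circlePhase_sub_le β hw hζ hr0 hr1 hrζ t
      _ = _ := by ring
  · rw [Set.indicator_of_notMem ht, zero_sub, norm_neg, Complex.norm_exp, ← mul_assoc]
    have hs : 1 ≤ s := by
      refine le_trans ?_ (abs_le_norm_tangentDisplacement hw hζ t)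
      by_contra! hlt
      exact ht ⟨by linarith [(abs_lt.1 hlt).1, Real.pi_gt_three],
        by linarith [(abs_lt.1 hlt).2, Real.pi_gt_three]⟩
    have hfactor : 1 ≤ (12 * ‖β‖ + 1) * (κ * s ^ 3) :=
      one_le_mul_of_one_le_of_one_le (by linarith [norm_nonneg β])
        (one_le_mul_of_one_le_of_one_le hκ (one_le_pow₀ hs))
    exact (Real.exp_le_exp.2 htangent).trans (le_mul_of_one_le_left (Real.exp_pos _).le hfactor)

theorem integrable_exp_tangentPhase (hc : 0 < c) (hβ : ∀ v, (β v v).re ≤ -c * ‖v‖ ^ 2)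
    (hw : ‖w‖ = 1) (hζ : inner ℂ w ζ = 0) {κ : ℝ} (hκ : 0 < κ) :
    Integrable fun t : ℝ =>
      Complex.exp (κ * β (tangentDisplacement w ζ t) (tangentDisplacement w ζ t)) := by
  refine (integrable_exp_neg_mul_sq (mul_pos hκ hc)).mono' ?_ (.of_forall fun t => ?_)
  · exact (continuous_const.mul (continuous_tangentPhase β w ζ)).cexp.aestronglyMeasurable
  · have hre := (hβ (tangentDisplacement w ζ t)).trans (b := -c * _) (c := -c * t ^ 2) (by
      rw [norm_tangentDisplacement_sq hw hζ]
      nlinarith [sq_nonneg ‖ζ‖])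
    rw [Complex.norm_exp, Complex.re_ofReal_mul]
    exact Real.exp_le_exp.2 (by linarith [mul_le_mul_of_nonneg_left hre hκ.le])

theorem integral_exp_tangentPhase_eq [IsScalarTower ℝ ℂ E] (β : E →L[ℝ] E →L[ℝ] ℂ) (w ζ : E)
    {κ : ℝ} (hκ : 0 < κ) :
    1 / (2 * Real.pi) *
      ∫ t : ℝ, Complex.exp (κ * β (tangentDisplacement w ζ t) (tangentDisplacement w ζ t)) =
    (√κ : ℂ)⁻¹ * symbolIntegral β w (√κ • ζ) := by
  have hhom : ∀ t : ℝ, κ * β (tangentDisplacement w ζ t) (tangentDisplacement w ζ t) =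
      β (tangentDisplacement w (√κ • ζ) (√κ * t)) (tangentDisplacement w (√κ • ζ) (√κ * t)) := by
    intro t
    have hscale : tangentDisplacement w (√κ • ζ) (√κ * t) = √κ • tangentDisplacement w ζ t := by
      rw [tangentDisplacement, tangentDisplacement, smul_add, ← smul_assoc]
      simp [mul_left_comm]
    rw [hscale, map_smul, map_smul, smul_apply, smul_smul,
      Real.mul_self_sqrt hκ.le, Complex.real_smul]
  simp only [hhom]
  rw [Measure.integral_comp_mul_left (fun t => Complex.exp
      (β (tangentDisplacement w (√κ • ζ) t) (tangentDisplacement w (√κ • ζ) t))),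
    symbolIntegral, abs_of_pos (inv_pos.2 (Real.sqrt_pos.2 hκ)), Complex.real_smul,
    Complex.ofReal_inv, mul_left_comm]

theorem integrable_exp_neg_mul_sq_add {a : ℝ} (ha : 0 < a) (d : ℝ) :
    Integrable fun t : ℝ => Real.exp (-a * (t ^ 2 + d)) := by
  simp only [mul_add, Real.exp_add]
  exact (integrable_exp_neg_mul_sq ha).mul_const _

theorem integral_exp_neg_mul_sq_add (a d : ℝ) :
    ∫ t : ℝ, Real.exp (-a * (t ^ 2 + d)) = √(Real.pi / a) * Real.exp (-a * d) := by
  simp only [mul_add, Real.exp_add]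
  rw [integral_mul_const, integral_gaussian]

theorem exists_norm_indicator_exp_circlePhase_sub_le (hc : 0 < c)
    (hβ : ∀ v, (β v v).re ≤ -c * ‖v‖ ^ 2) (hw : ‖w‖ = 1) :
    ∃ M > 0, ∃ a > 0, ∀ (κ : ℝ) (ζ : E) (r t : ℝ), 1 ≤ κ → inner ℂ w ζ = 0 → 0 ≤ r → r ≤ 1 →
      1 - r ≤ ‖ζ‖ ^ 2 →
      ‖(Set.Ioc (-Real.pi) Real.pi).indicator
          (fun t => Complex.exp (κ * circlePhase β w ((r : ℂ) • w + ζ) t)) t -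
        Complex.exp (κ * β (tangentDisplacement w ζ t) (tangentDisplacement w ζ t))‖ ≤
      M * (√κ)⁻¹ * Real.exp (-(a * κ) * (t ^ 2 + ‖ζ‖ ^ 2)) := by
  have hb : 0 < c / (2 * Real.pi ^ 2) := by positivity
  refine ⟨(12 * ‖β‖ + 1) * (1 + 8 / (c / (2 * Real.pi ^ 2)) ^ 2), by positivity,
    c / (2 * Real.pi ^ 2) / 2, by positivity, fun κ ζ r t hκ hζ hr0 hr1 hrζ => ?_⟩
  refine (norm_indicator_exp_circlePhase_sub_le hc.le hβ hw hζ hr0 hr1 hrζ hκ t).trans ?_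
  rw [← norm_tangentDisplacement_sq hw hζ, ← neg_mul, mul_assoc (12 * ‖β‖ + 1),
    mul_assoc (12 * ‖β‖ + 1)]
  exact mul_le_mul_of_nonneg_left
    (mul_cube_mul_exp_neg_mul_sq_le hb (one_pos.trans_le hκ) _) (by positivity)

theorem exists_norm_circleIntegral_sub_symbolIntegral_le [IsScalarTower ℝ ℂ E] (hc : 0 < c)
    (hβ : ∀ v, (β v v).re ≤ -c * ‖v‖ ^ 2) (hw : ‖w‖ = 1) :
    ∃ C > 0, ∃ a > 0, ∀ (κ : ℝ) (ζ : E) (r : ℝ), 1 ≤ κ → inner ℂ w ζ = 0 → 0 ≤ r → r ≤ 1 →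
      1 - r ≤ ‖ζ‖ ^ 2 →
      ‖1 / (2 * Real.pi) * (∫ t in -Real.pi..Real.pi,
          Complex.exp (κ * circlePhase β w ((r : ℂ) • w + ζ) t)) -
        (√κ : ℂ)⁻¹ * symbolIntegral β w (√κ • ζ)‖ ≤ C * κ⁻¹ * Real.exp (-a * κ * ‖ζ‖ ^ 2) := by
  obtain ⟨M, hM, a, ha, hpointwise⟩ := exists_norm_indicator_exp_circlePhase_sub_le hc hβ hw
  refine ⟨M * √(Real.pi / a), by positivity, a, ha, fun κ ζ r hκ hζ hr0 hr1 hrζ => ?_⟩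
  have hκ0 : 0 < κ := one_pos.trans_le hκ
  have hcircle : Integrable ((Set.Ioc (-Real.pi) Real.pi).indicator
      fun t => Complex.exp (κ * circlePhase β w ((r : ℂ) • w + ζ) t)) := by
    rw [integrable_indicator_iff measurableSet_Ioc]
    have hcont := continuous_circlePhase β w ((r : ℂ) • w + ζ)
    exact (continuous_const.mul hcont).cexp.integrableOn_Icc.mono_set Set.Ioc_subset_Icc_self
  have hpi : ‖(1 / (2 * Real.pi) : ℂ)‖ ≤ 1 := by
    rw [← Complex.ofReal_ofNat, ← Complex.ofReal_mul, ← Complex.ofReal_one, ← Complex.ofReal_div,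
      Complex.norm_real, Real.norm_of_nonneg (by positivity), div_le_one (by positivity)]
    linarith [Real.pi_gt_three]
  rw [← integral_exp_tangentPhase_eq β w ζ hκ0, ← mul_sub,
    intervalIntegral.integral_of_le (by linarith [Real.pi_pos]),
    ← integral_indicator measurableSet_Ioc,
    ← integral_sub hcircle (integrable_exp_tangentPhase hc hβ hw hζ hκ0), norm_mul]
  calc _ ≤ 1 * ∫ t : ℝ, M * (√κ)⁻¹ * Real.exp (-(a * κ) * (t ^ 2 + ‖ζ‖ ^ 2)) := by
        gcongr
        exact norm_integral_le_of_norm_le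
          ((integrable_exp_neg_mul_sq_add (by positivity) _).const_mul _)
          (.of_forall fun t => hpointwise κ ζ r t hκ hζ hr0 hr1 hrζ)
    _ = M * √(Real.pi / a) * (√κ * √κ)⁻¹ * Real.exp (-(a * κ) * ‖ζ‖ ^ 2) := by
        rw [integral_const_mul, integral_exp_neg_mul_sq_add, ← div_div, Real.sqrt_div' _ hκ0.le]
        ring
    _ = _ := by rw [Real.mul_self_sqrt hκ0.le, neg_mul a]

end StationaryPhase

section GaussianStates

variable {N : ℕ}

theorem exists_re_apply_self_le {E : Type*} [NormedAddCommGroup E] [NormedSpace ℝ E]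
    [FiniteDimensional ℝ E] {β : E →L[ℝ] E →L[ℝ] ℂ} (hβ : ∀ v, v ≠ 0 → (β v v).re < 0) :
    ∃ c > 0, ∀ v, (β v v).re ≤ -c * ‖v‖ ^ 2 := by
  rcases subsingleton_or_nontrivial E with hE | hE
  · exact ⟨1, one_pos, fun v => by simp [Subsingleton.elim v 0]⟩
  obtain ⟨u, hu, hmax⟩ := (isCompact_sphere (0 : E) 1).exists_isMaxOn
    (NormedSpace.sphere_nonempty.2 zero_le_one)
    (show Continuous fun v => (β v v).re by fun_prop).continuousOn
  refine ⟨-(β u u).re, neg_pos.2 (hβ u (ne_zero_of_mem_unit_sphere ⟨u, hu⟩)), fun v => ?_⟩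
  rcases eq_or_ne v 0 with rfl | hv
  · simp
  have hunit : ‖v‖⁻¹ • v ∈ Metric.sphere (0 : E) 1 := by
    simp [norm_smul, norm_ne_zero_iff.2 hv]
  have hle : (β (‖v‖⁻¹ • v) (‖v‖⁻¹ • v)).re ≤ (β u u).re := hmax hunit
  simp only [map_smul, smul_apply, Complex.smul_re, smul_eq_mul] at hle
  rw [neg_neg, mul_comm]
  calc (β v v).re = ‖v‖ ^ 2 * (‖v‖⁻¹ * (‖v‖⁻¹ * (β v v).re)) := by
        field_simp [norm_ne_zero_iff.2 hv]
    _ ≤ ‖v‖ ^ 2 * (β u u).re := by gcongr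

/-- The real bilinear form whose diagonal is the exponent `Q_A(v)/2 - |v|²/2` of a Gaussian state
centred at the origin. -/
def gaussForm (A : Matrix (Fin N) (Fin N) ℂ) : CN N →L[ℝ] CN N →L[ℝ] ℂ :=
  (LinearMap.mk₂ ℝ
    (fun u v : CN N => (∑ i, ∑ j, u i * A i j * v j) / 2 - ((inner ℝ u v : ℝ) : ℂ) / 2)
    (fun u u' v => by
      simp only [PiLp.add_apply, add_mul, Finset.sum_add_distrib, inner_add_left,
        Complex.ofReal_add]
      ring)
    (fun c u v => by
      simp only [PiLp.smul_apply, Complex.real_smul, real_inner_smul_left, Complex.ofReal_mul,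
        mul_assoc, ← Finset.mul_sum]
      ring)
    (fun u v v' => by
      simp only [PiLp.add_apply, mul_add, Finset.sum_add_distrib, inner_add_right,
        Complex.ofReal_add]
      ring)
    (fun c u v => by
      simp only [PiLp.smul_apply, Complex.real_smul, real_inner_smul_right, Complex.ofReal_mul,
        mul_left_comm _ (c : ℂ), ← Finset.mul_sum]
      ring)).toContinuousBilinearMap

theorem gaussForm_self (A : Matrix (Fin N) (Fin N) ℂ) (v : CN N) :
    gaussForm A v v = quadForm A v / 2 - ((‖v‖ ^ 2 : ℝ) : ℂ) / 2 := by
  rw [← real_inner_self_eq_norm_sq]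
  rfl

theorem re_gaussForm_self_neg {A : Matrix (Fin N) (Fin N) ℂ} {v : CN N}
    (hA : (quadForm A v).re < ‖v‖ ^ 2) : (gaussForm A v v).re < 0 := by
  rw [gaussForm_self, Complex.sub_re, Complex.div_ofNat_re, Complex.div_ofNat_re,
    Complex.ofReal_re]
  linarith

theorem quadForm_eq_inner (A : Matrix (Fin N) (Fin N) ℂ) (v : CN N) :
    quadForm A v = inner ℂ (WithLp.toLp 2 (star v.ofLp) : CN N) (WithLp.toLp 2 (A *ᵥ v.ofLp)) := by
  simp only [quadForm, EuclideanSpace.inner_toLp_toLp, star_star, Matrix.mulVec, dotProduct,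
    Finset.sum_mul]
  refine Finset.sum_congr rfl fun i _ => Finset.sum_congr rfl fun j _ => by ring

theorem norm_mulVec_lt_of_mem_genDisk {A : Matrix (Fin N) (Fin N) ℂ} (hA : A ∈ genDisk N)
    {v : CN N} (hv : v ≠ 0) : ‖(WithLp.toLp 2 (A *ᵥ v.ofLp) : CN N)‖ < ‖v‖ := by
  have hnorm : ∀ x : CN N, star x.ofLp ⬝ᵥ x.ofLp = ((‖x‖ ^ 2 : ℝ) : ℂ) := fun x => by
    rw [dotProduct_comm, ← EuclideanSpace.inner_eq_star_dotProduct, inner_self_eq_norm_sq_to_K]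
    norm_cast
  have hpos := hA.2.dotProduct_mulVec_pos (x := v.ofLp) (by simpa using hv)
  rw [Matrix.sub_mulVec, Matrix.one_mulVec, dotProduct_sub, ← Matrix.mulVec_mulVec,
    Matrix.dotProduct_mulVec, ← Matrix.star_mulVec, hnorm, hnorm (WithLp.toLp 2 (A *ᵥ v.ofLp)),
    ← Complex.ofReal_sub, Complex.zero_lt_real, sub_pos] at hpos
  exact lt_of_pow_lt_pow_left₀ 2 (norm_nonneg _) hpos

theorem re_quadForm_lt_of_mem_genDisk {A : Matrix (Fin N) (Fin N) ℂ} (hA : A ∈ genDisk N)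
    {v : CN N} (hv : v ≠ 0) : (quadForm A v).re < ‖v‖ ^ 2 := by
  have hstar : ‖(WithLp.toLp 2 (star v.ofLp) : CN N)‖ = ‖v‖ := by simp [EuclideanSpace.norm_eq]
  calc (quadForm A v).re ≤ ‖quadForm A v‖ := Complex.re_le_norm _
    _ ≤ ‖v‖ * ‖(WithLp.toLp 2 (A *ᵥ v.ofLp) : CN N)‖ := by
        rw [quadForm_eq_inner, ← hstar]
        exact norm_inner_le_norm _ _
    _ < ‖v‖ ^ 2 := by
        rw [sq]
        exact mul_lt_mul_of_pos_left (norm_mulVec_lt_of_mem_genDisk hA hv) (norm_pos_iff.2 hv)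

theorem hermPair_eq_inner (z w : CN N) : hermPair z w = inner ℂ w z := by
  simp [hermPair, PiLp.inner_apply]

theorem exp_mul_gaussianState (k : ℕ) (A : Matrix (Fin N) (Fin N) ℂ) {w : CN N} (hw : ‖w‖ = 1)
    (z : CN N) (t : ℝ) :
    Complex.exp (-(Complex.I * k * t)) *
        gaussianState k A w (Complex.exp (Complex.I * t) • z) =
      Complex.exp (k * circlePhase (gaussForm A) w z t) := by
  rw [circlePhase, circleDisplacement, ← inner_smul_right, gaussForm_self, gaussianState,
    hermPair_eq_inner]
  generalize Complex.exp (Complex.I * t) • z = y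
  rw [norm_sub_sq (𝕜 := ℂ), inner_re_symm, hw, ← Complex.exp_add, ← Complex.exp_add,
    ← Complex.exp_add, ← Complex.exp_add]
  congr 1
  rw [RCLike.re_eq_complex_re]
  push_cast
  linear_combination -(k : ℂ) * Complex.re_add_im (inner ℂ w y)

theorem periodic_reduction_integrand (k : ℕ) (ψ : CN N → ℂ) (z : CN N) :
    Function.Periodic (fun t : ℝ => Complex.exp (-(Complex.I * k * t)) *
      ψ (Complex.exp (Complex.I * t) • z)) (2 * Real.pi) := fun t => by
  have horbit : Complex.exp (Complex.I * (t + 2 * Real.pi : ℝ)) = Complex.exp (Complex.I * t) := by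
    rw [← Complex.exp_periodic (Complex.I * t)]
    push_cast
    ring_nf
  have hweight : Complex.exp (-(Complex.I * k * (t + 2 * Real.pi : ℝ))) =
      Complex.exp (-(Complex.I * k * t)) := by
    rw [← Complex.exp_periodic.sub_nat_mul_eq k (x := -(Complex.I * k * t))]
    push_cast
    ring_nf
  simp only [horbit, hweight]

theorem reduction_exp_smul (k : ℕ) (ψ : CN N → ℂ) (z : CN N) (θ : ℝ) :
    reduction k ψ (Complex.exp (Complex.I * θ) • z) =
      Complex.exp (Complex.I * k * θ) * reduction k ψ z := by
  have hshift : ∀ t : ℝ, Complex.exp (-(Complex.I * k * t)) *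
        ψ (Complex.exp (Complex.I * t) • Complex.exp (Complex.I * θ) • z) =
      Complex.exp (Complex.I * k * θ) * (Complex.exp (-(Complex.I * k * (t + θ : ℝ))) *
        ψ (Complex.exp (Complex.I * (t + θ : ℝ)) • z)) := fun t => by
    rw [smul_smul, ← Complex.exp_add, ← mul_assoc, ← Complex.exp_add]
    push_cast
    ring_nf
  have hperiod := (periodic_reduction_integrand k ψ z).intervalIntegral_add_eq θ 0
  rw [zero_add] at hperiod
  rw [reduction, reduction]
  simp only [hshift]
  rw [intervalIntegral.integral_const_mul, intervalIntegral.integral_comp_add_right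
    (fun t : ℝ => Complex.exp (-(Complex.I * k * t)) * ψ (Complex.exp (Complex.I * t) • z)),
    zero_add, add_comm (2 * Real.pi) θ, hperiod, mul_left_comm]

theorem reducedState_eq_integral_circlePhase (k : ℕ) (A : Matrix (Fin N) (Fin N) ℂ) {w : CN N}
    (hw : ‖w‖ = 1) (z : CN N) :
    reducedState k A w z = 1 / (2 * Real.pi) *
      ∫ t in -Real.pi..Real.pi, Complex.exp (k * circlePhase (gaussForm A) w z t) := by
  have hperiod := (periodic_reduction_integrand k (gaussianState k A w) z).intervalIntegral_add_eq
    0 (-Real.pi)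
  rw [zero_add, show -Real.pi + 2 * Real.pi = Real.pi by ring] at hperiod
  rw [reducedState, reduction, hperiod]
  simp only [exp_mul_gaussianState k A hw]

theorem exists_norm_reducedState_sub_symbolIntegral_le {A : Matrix (Fin N) (Fin N) ℂ}
    (hA : ∀ v, v ≠ 0 → (quadForm A v).re < ‖v‖ ^ 2) {w : CN N} (hw : ‖w‖ = 1) :
    ∃ C > 0, ∃ a > 0, ∀ (k : ℕ) (ζ : CN N) (r : ℝ), 0 < k → inner ℂ w ζ = 0 → 0 ≤ r → r ≤ 1 →
      1 - r ≤ ‖ζ‖ ^ 2 →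
      ‖reducedState k A w ((r : ℂ) • w + ζ) -
          (√(k : ℝ) : ℂ)⁻¹ * symbolIntegral (gaussForm A) w (√(k : ℝ) • ζ)‖ ≤
        C * (k : ℝ)⁻¹ * Real.exp (-a * k * ‖ζ‖ ^ 2) := by
  obtain ⟨c, hc, hcoercive⟩ :=
    exists_re_apply_self_le fun v hv => re_gaussForm_self_neg (hA v hv)
  obtain ⟨C, hC, a, ha, hphase⟩ :=
    exists_norm_circleIntegral_sub_symbolIntegral_le hc hcoercive hw
  refine ⟨C, hC, a, ha, fun k ζ r hk hζ hr0 hr1 hrζ => ?_⟩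
  rw [reducedState_eq_integral_circlePhase k A hw]
  exact mod_cast hphase k ζ r (mod_cast hk) hζ hr0 hr1 hrζ

theorem tendsto_rescaledState {A : Matrix (Fin N) (Fin N) ℂ}
    (hA : ∀ v, v ≠ 0 → (quadForm A v).re < ‖v‖ ^ 2) {w : CN N} (hw : ‖w‖ = 1)
    (η : horizontal w) :
    Tendsto (rescaledState A w η) atTop (𝓝 (symbolIntegral (gaussForm A) w η)) := by
  obtain ⟨C, hC, a, ha, hphase⟩ := exists_norm_reducedState_sub_symbolIntegral_le hA hw
  have hlim : Tendsto (fun k : ℕ => C * (√(k : ℝ))⁻¹) atTop (𝓝 0) := by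
    rw [← mul_zero C]
    exact (tendsto_inv_atTop_zero.comp
      (Real.tendsto_sqrt_atTop.comp tendsto_natCast_atTop_atTop)).const_mul C
  refine tendsto_iff_norm_sub_tendsto_zero.2
    (squeeze_zero' (.of_forall fun _ => norm_nonneg _) ?_ hlim)
  filter_upwards [eventually_gt_atTop 0] with k hk
  have hsqrt : 0 < √(k : ℝ) := Real.sqrt_pos.2 (mod_cast hk)
  have hη : inner ℂ w ((√(k : ℝ))⁻¹ • (η : CN N)) = 0 := by
    rw [inner_smul_right_eq_smul, Submodule.mem_orthogonal_singleton_iff_inner_right.1 η.2,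
      smul_zero]
  have hbound := hphase k _ 1 hk hη zero_le_one le_rfl (by rw [sub_self]; positivity)
  rw [smul_inv_smul₀ hsqrt.ne', Complex.ofReal_one, one_smul] at hbound
  have hfactor : rescaledState A w η k - symbolIntegral (gaussForm A) w η =
      √(k : ℝ) * (reducedState k A w (w + (√(k : ℝ))⁻¹ • (η : CN N)) -
        (√(k : ℝ) : ℂ)⁻¹ * symbolIntegral (gaussForm A) w η) := by
    rw [mul_sub, mul_inv_cancel_left₀ (Complex.ofReal_ne_zero.2 hsqrt.ne'), rescaledState,
      ← Complex.coe_algebraMap, algebraMap_smul]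
  rw [hfactor, norm_mul, Complex.norm_real, Real.norm_of_nonneg hsqrt.le]
  calc _ ≤ √(k : ℝ) * (C * (k : ℝ)⁻¹ * 1) := by
        gcongr
        refine hbound.trans ?_
        gcongr
        exact Real.exp_le_one_iff.2 (by rw [neg_mul, neg_mul, neg_nonpos]; positivity)
    _ = C * (√(k : ℝ))⁻¹ := by
        rw [mul_one, mul_left_comm, ← div_eq_mul_inv, Real.sqrt_div_self]

theorem symbol_eq_symbolIntegral {A : Matrix (Fin N) (Fin N) ℂ}
    (hA : ∀ v, v ≠ 0 → (quadForm A v).re < ‖v‖ ^ 2) {w : CN N} (hw : ‖w‖ = 1)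
    (η : horizontal w) : symbol A w η = symbolIntegral (gaussForm A) w η :=
  (tendsto_rescaledState hA hw η).limUnder_eq

end GaussianStates

section SymbolDetermines

variable {N : ℕ}

theorem exists_norm_reducedState_sub_reducedState_le {A B : Matrix (Fin N) (Fin N) ℂ}
    (hA : ∀ v, v ≠ 0 → (quadForm A v).re < ‖v‖ ^ 2)
    (hB : ∀ v, v ≠ 0 → (quadForm B v).re < ‖v‖ ^ 2) {w : CN N} (hw : ‖w‖ = 1)
    (hsymbol : symbol A w = symbol B w) :
    ∃ C > 0, ∃ a > 0, ∀ (k : ℕ) (z : CN N), 0 < k → ‖z‖ = 1 →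
      ‖reducedState k A w z - reducedState k B w z‖ ≤
        C * (k : ℝ)⁻¹ * Real.exp (-a * k * ‖(horizontal w).starProjection z‖ ^ 2) := by
  obtain ⟨C₁, hC₁, a₁, ha₁, hboundA⟩ := exists_norm_reducedState_sub_symbolIntegral_le hA hw
  obtain ⟨C₂, hC₂, a₂, ha₂, hboundB⟩ := exists_norm_reducedState_sub_symbolIntegral_le hB hw
  refine ⟨C₁ + C₂, add_pos hC₁ hC₂, min a₁ a₂, lt_min ha₁ ha₂, fun k z hk hz => ?_⟩
  obtain ⟨θ, r, ζ, hζ, hr0, hr1, hrζ, hnorm, rfl⟩ := exists_eq_exp_smul_of_norm_eq_one hw hz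
  have hmem : √(k : ℝ) • ζ ∈ horizontal w := Submodule.smul_of_tower_mem _ _
    (Submodule.mem_orthogonal_singleton_iff_inner_right.2 hζ)
  have hagree := congrFun hsymbol ⟨_, hmem⟩
  rw [symbol_eq_symbolIntegral hA hw, symbol_eq_symbolIntegral hB hw] at hagree
  have hphase : ‖Complex.exp (Complex.I * k * θ)‖ = 1 := by
    simpa [mul_assoc] using Complex.norm_exp_I_mul_ofReal (k * θ)
  have hdiffA := hboundA k ζ r hk hζ hr0 hr1 hrζ
  have hdiffB := hboundB k ζ r hk hζ hr0 hr1 hrζ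
  rw [hagree] at hdiffA
  rw [← hnorm, reducedState, reducedState, reduction_exp_smul, reduction_exp_smul, ← mul_sub,
    norm_mul, hphase, one_mul]
  refine (norm_sub_le_norm_sub_add_norm_sub _ _ _).trans
    ((add_le_add hdiffA ((norm_sub_rev _ _).trans_le hdiffB)).trans ?_)
  rw [add_mul C₁, add_mul]
  gcongr
  · exact min_le_left _ _
  · exact min_le_right _ _

theorem integral_sphere_exp_neg_norm_horizontal_sq_le {w : CN N} (hw : ‖w‖ = 1) {b : ℝ}
    (hb : 0 < b) :
    ∫ z : Metric.sphere (0 : CN N) 1, Real.exp (-b * ‖(horizontal w).starProjection (z : CN N)‖ ^ 2)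
        ∂((volume : Measure (CN N)).toSphere) ≤
      2 * N * Real.exp 1 * Real.pi * (Real.pi / b) ^ (N - 1) := by
  set K := (horizontal w).restrictScalars ℝ
  have hproj : ∀ z, K.starProjection z = (horizontal w).starProjection z := fun z => by
    refine Submodule.eq_starProjection_of_mem_of_inner_eq_zero
      (Submodule.starProjection_apply_mem (horizontal w) z) fun v hv => ?_
    have hre : ∀ x y : CN N, inner ℝ x y = (inner ℂ x y).re := fun x y => by
      simp [PiLp.inner_apply, Complex.inner]
    rw [hre, (horizontal w).starProjection_inner_eq_zero z v hv, Complex.zero_re]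
  have hspan : Module.finrank ℂ (Submodule.span ℂ {w}) = 1 :=
    finrank_span_singleton (norm_pos_iff.1 (hw ▸ one_pos))
  have hN : 1 + Module.finrank ℂ (horizontal w) = N := by
    rw [← hspan, Submodule.finrank_add_finrank_orthogonal, finrank_euclideanSpace_fin]
  have hreal := Submodule.finrank_add_finrank_orthogonal K
  have hdim : Module.finrank ℝ (CN N) = 2 * N := by
    rw [finrank_real_of_complex, finrank_euclideanSpace_fin]
  have hK : Module.finrank ℝ K = 2 * (N - 1) :=
    (finrank_real_of_complex (horizontal w)).trans (by omega)
  have hKperp : Module.finrank ℝ Kᗮ = 2 := by omega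
  have hbound := integral_sphere_exp_neg_norm_starProjection_sq_le K hb
  simp only [hproj, hdim, hK, hKperp] at hbound
  refine hbound.trans_eq ?_
  push_cast
  rw [mul_div_cancel_left₀ _ two_ne_zero, Real.rpow_natCast, div_self two_ne_zero, Real.rpow_one]
  ring

theorem isBigO_sphereNormSq {A B : Matrix (Fin N) (Fin N) ℂ}
    (hA : ∀ v, v ≠ 0 → (quadForm A v).re < ‖v‖ ^ 2)
    (hB : ∀ v, v ≠ 0 → (quadForm B v).re < ‖v‖ ^ 2) {w : CN N} (hw : ‖w‖ = 1)
    (hsymbol : symbol A w = symbol B w) :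
    (fun k : ℕ => sphereNormSq (reducedState k A w - reducedState k B w))
      =O[atTop] (fun k : ℕ => (k : ℝ) ^ (-(N : ℤ) - 1)) := by
  obtain ⟨C, hC, a, ha, hpointwise⟩ :=
    exists_norm_reducedState_sub_reducedState_le hA hB hw hsymbol
  have hN : N ≠ 0 := by
    rintro rfl
    simp [Subsingleton.elim w 0] at hw
  refine IsBigO.of_bound
    (C ^ 2 * (2 * N * Real.exp 1 * Real.pi * (Real.pi / (2 * a)) ^ (N - 1))) ?_
  filter_upwards [eventually_gt_atTop 0] with k hk
  have hexponent : (k : ℝ) ^ (-(N : ℤ) - 1) = (k : ℝ)⁻¹ ^ 2 * (k : ℝ)⁻¹ ^ (N - 1) := by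
    rw [← pow_add, show 2 + (N - 1) = N + 1 by omega, inv_pow, ← zpow_natCast, ← zpow_neg,
      Nat.cast_succ, neg_add']
  have hint : Integrable (fun z : Metric.sphere (0 : CN N) 1 => (C * (k : ℝ)⁻¹) ^ 2 *
      Real.exp (-(2 * a * k) * ‖(horizontal w).starProjection (z : CN N)‖ ^ 2))
      ((volume : Measure (CN N)).toSphere) :=
    Continuous.integrable_of_hasCompactSupport (by fun_prop) (HasCompactSupport.of_compactSpace _)
  have hnonneg : 0 ≤ sphereNormSq (reducedState k A w - reducedState k B w) :=
    integral_nonneg fun _ => sq_nonneg _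
  rw [Real.norm_of_nonneg hnonneg, Real.norm_of_nonneg (by positivity), hexponent]
  calc sphereNormSq (reducedState k A w - reducedState k B w)
      ≤ ∫ z : Metric.sphere (0 : CN N) 1, (C * (k : ℝ)⁻¹) ^ 2 *
          Real.exp (-(2 * a * k) * ‖(horizontal w).starProjection (z : CN N)‖ ^ 2)
          ∂((volume : Measure (CN N)).toSphere) := by
        refine integral_mono (integrable_reducedState_sub k A B w) hint fun z => ?_
        refine (pow_le_pow_left₀ (norm_nonneg _) (hpointwise k z hk (by simp)) 2).trans_eq ?_
        rw [mul_pow, ← Real.exp_nat_mul]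
        congr 2
        push_cast
        ring
    _ ≤ (C * (k : ℝ)⁻¹) ^ 2 *
          (2 * N * Real.exp 1 * Real.pi * (Real.pi / (2 * a * k)) ^ (N - 1)) := by
        rw [integral_const_mul]
        gcongr
        exact integral_sphere_exp_neg_norm_horizontal_sq_le hw (by positivity)
    _ = _ := by
        rw [← div_div, div_eq_mul_inv _ (k : ℝ), mul_pow, mul_pow]
        ring

end SymbolDetermines

end Squeezed

end

theorem corollary3p2_general (N : ℕ) (A B : Matrix (Fin N) (Fin N) ℂ)
    (hA : ∀ v : Squeezed.CN N, v ≠ 0 → (Squeezed.quadForm A v).re < ‖v‖ ^ 2)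
    (hB : ∀ v : Squeezed.CN N, v ≠ 0 → (Squeezed.quadForm B v).re < ‖v‖ ^ 2)
    (w : Squeezed.CN N) (hw : ‖w‖ = 1) :
    (∀ η : Squeezed.horizontal w,
      Tendsto (Squeezed.rescaledState A w η) atTop (𝓝 (Squeezed.symbol A w η))) ∧
    (∀ η : Squeezed.horizontal w,
      Tendsto (Squeezed.rescaledState B w η) atTop (𝓝 (Squeezed.symbol B w η))) ∧
    (Squeezed.symbol A w = Squeezed.symbol B w →
      (fun k : ℕ => Squeezed.sphereNormSq
        (Squeezed.reducedState k A w - Squeezed.reducedState k B w))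
        =O[atTop] (fun k : ℕ => (k : ℝ) ^ (-(N : ℤ) - 1))) := by
  refine ⟨fun η => ?_, fun η => ?_, Squeezed.isBigO_sphereNormSq hA hB hw⟩
  · rw [Squeezed.symbol_eq_symbolIntegral hA hw]
    exact Squeezed.tendsto_rescaledState hA hw η
  · rw [Squeezed.symbol_eq_symbolIntegral hB hw]
    exact Squeezed.tendsto_rescaledState hB hw η

theorem corollary3p2 (N : ℕ) (A B : Matrix (Fin N) (Fin N) ℂ)
    (hA : A ∈ Squeezed.genDisk N) (hB : B ∈ Squeezed.genDisk N)
    (w : Squeezed.CN N) (hw : ‖w‖ = 1) :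
    (∀ η : Squeezed.horizontal w,
      Tendsto (Squeezed.rescaledState A w η) atTop (𝓝 (Squeezed.symbol A w η))) ∧
    (∀ η : Squeezed.horizontal w,
      Tendsto (Squeezed.rescaledState B w η) atTop (𝓝 (Squeezed.symbol B w η))) ∧
    (Squeezed.symbol A w = Squeezed.symbol B w →
      (fun k : ℕ => Squeezed.sphereNormSq
        (Squeezed.reducedState k A w - Squeezed.reducedState k B w))
        =O[atTop] (fun k : ℕ => (k : ℝ) ^ (-(N : ℤ) - 1))) := by
  exact corollary3p2_general N A B (fun _ => Squeezed.re_quadForm_lt_of_mem_genDisk hA)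
    (fun _ => Squeezed.re_quadForm_lt_of_mem_genDisk hB) w hw
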